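/- Let $R$ be a commutative Noetherian ring and let $\Phi$ be a system of ideals of $R$, i.e. a non-empty set of ideals such that for all $\mathfrak a_1,\mathfrak a_2\in\Phi$ there is $\mathfrak b\in\Phi$ with $\mathfrak b\subseteq\mathfrak a_1\mathfrak a_2$. For an $R$-module $M$ put $\Gamma_\Phi(M)=\{x\in M\mid \mathfrak a x=0\text{ for some }\mathfrak a\in\Phi\}$, let $H^i_\Phi$ be the $i$-th right derived functor of $\Gamma_\Phi$, and for an ideal $\mathfrak a$ let $H^i_{\mathfrak a}(M)=\varinjlim_n\operatorname{Ext}^i_R(R/\mathfrak a^n,M)$ be the $i$-th local cohomology module. The dimension $\dim_R N$ of an $R$-module $N$ is the Krull dimension of its support, with $\dim 0=-1$. Let $k$ be an integer, let $\mathcal S$ be the class of all $R$-modules $N$ with $\dim_R N\le k$, let $M$ be an arbitrary $R$-module and let $t\ge 0$ be an integer. Then the following are equivalent: (i) $H^i_\Phi(M)\in\mathcal S$ for all $i<t$; (ii) $H^i_{\mathfrak a}(M)\in\mathcal S$ for all $i<t$ and all $\mathfrak a\in\Phi$. Likewise, $H^i_\Phi(M)\in\mathcal S$ for all $i\ge 0$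 if and only if $H^i_{\mathfrak a}(M)\in\mathcal S$ for all $i\ge 0$ and all $\mathfrak a\in\Phi$. -/

import Mathlib

open CategoryTheory

universe u

/-- A system of ideals of `R`: a non-empty set `Φ` of ideals such that any product `𝔞 * 𝔟` of two
members contains a member. -/
structure SystemOfIdeals (R : Type u) [CommRing R] where
  carrier : Set (Ideal R)
  nonempty : carrier.Nonempty
  exists_le_mul : ∀ 𝔞 ∈ carrier, ∀ 𝔟 ∈ carrier, ∃ 𝔠 ∈ carrier, 𝔠 ≤ 𝔞 * 𝔟

namespace SystemOfIdeals

variable {R : Type u} [CommRing R]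

instance : Membership (Ideal R) (SystemOfIdeals R) := ⟨fun Φ 𝔞 => 𝔞 ∈ Φ.carrier⟩

/-- `Γ_Φ(M) = {x ∈ M | 𝔞 x = 0 for some 𝔞 ∈ Φ}`, as a submodule of `M`. -/
def torsion (Φ : SystemOfIdeals R) (M : Type u) [AddCommGroup M] [Module R M] :
    Submodule R M where
  carrier := {x | ∃ 𝔞 ∈ Φ, ∀ r ∈ 𝔞, r • x = 0}
  zero_mem' := by
    obtain ⟨𝔞, h𝔞⟩ := Φ.nonempty
    exact ⟨𝔞, h𝔞, fun r _ => smul_zero r⟩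
  add_mem' := by
    rintro x y ⟨𝔞, h𝔞, hx⟩ ⟨𝔟, h𝔟, hy⟩
    obtain ⟨𝔠, h𝔠, hle⟩ := Φ.exists_le_mul 𝔞 h𝔞 𝔟 h𝔟
    refine ⟨𝔠, h𝔠, fun r hr => ?_⟩
    have hr' : r ∈ 𝔞 ⊓ 𝔟 := Ideal.mul_le_inf (hle hr)
    rw [smul_add, hx r hr'.1, hy r hr'.2, add_zero]
  smul_mem' := by
    rintro s x ⟨𝔞, h𝔞, hx⟩
    exact ⟨𝔞, h𝔞, fun r hr => by rw [smul_comm, hx r hr, smul_zero]⟩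

theorem map_mem_torsion (Φ : SystemOfIdeals R) {M N : Type u} [AddCommGroup M] [Module R M]
    [AddCommGroup N] [Module R N] (f : M →ₗ[R] N) :
    ∀ x ∈ Φ.torsion M, f x ∈ Φ.torsion N := by
  rintro x ⟨𝔞, h𝔞, hx⟩
  exact ⟨𝔞, h𝔞, fun r hr => by rw [← map_smul, hx r hr, map_zero]⟩

/-- The functor `Γ_Φ` on `R`-modules; a morphism is sent to its restriction. -/
def torsionFunctor (Φ : SystemOfIdeals R) : ModuleCat.{u} R ⥤ ModuleCat.{u} R where
  obj M := ModuleCat.of R (Φ.torsion M)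
  map f := ModuleCat.ofHom (f.hom.restrict (Φ.map_mem_torsion f.hom))

instance (Φ : SystemOfIdeals R) : Φ.torsionFunctor.Additive where

/-- The general local cohomology functor `H^i_Φ`: the `i`-th right derived functor of `Γ_Φ`. -/
noncomputable def localCohomology (Φ : SystemOfIdeals R) (i : ℕ) :
    ModuleCat.{u} R ⥤ ModuleCat.{u} R :=
  Φ.torsionFunctor.rightDerived i

end SystemOfIdeals

/-- The Krull dimension of (the support of) an `R`-module, as an integer or `⊤`,
with the convention `dim 0 = -1`. -/
noncomputable def moduleDim (R : Type u) [CommRing R] (N : Type u) [AddCommGroup N] [Module R N] :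
    WithTop ℤ :=
  match Module.supportDim R N with
  | ⊥ => ((-1 : ℤ) : WithTop ℤ)
  | (n : ℕ∞) => n.map (fun m : ℕ => (m : ℤ))

/-- The class of all `R`-modules `N` with `dim N ≤ k`. -/
def dimLE (R : Type u) [CommRing R] (k : ℤ) : ObjectProperty (ModuleCat.{u} R) :=
  fun N => moduleDim R N ≤ (k : WithTop ℤ)

/-! For `k ≥ -1`, the condition `dim N ≤ k` says that the support of `N` lies in a fixed set `T` of
primes; for `k < -1` no module qualifies and both sides fail as soon as `t > 0`. So it suffices to
treat the class `supportIn T`, which is closed under submodules, quotients and extensions and is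
tested element by element.

The proof is an induction on `t` by dimension shifting. In degree 0, `Γ_Φ(M)` is the union of the
`Γ_𝔞(M)` for `𝔞 ∈ Φ` (`supportIn_torsion_iff`). If `Γ_Φ(M)` is supported in `T`, then `M` embeds in
an injective `E` with `Γ_Φ(E)` still supported in `T` (`exists_mono_injective_supportIn_torsion`);
this rests on Artin–Rees, which makes torsion submodules of injectives injective. With `C = E/M`,
both theories give isomorphisms `Hⁱ(C) ≅ Hⁱ⁺¹(M)` for `i ≥ 1` and an exact sequence `H⁰(E) ⟶ H⁰(C) ⟶
H¹(M) ⟶ 0` whose first term is negligible. The claim for `M` in degrees up to `t` thus reduces to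
that for `C` in degrees below `t`. -/

/-! ### Torsion submodules of injective modules -/

namespace SystemOfIdeals

variable {R : Type u} [CommRing R]

/-- The system of ideals consisting of the powers of a single ideal. -/
def powers (𝔞 : Ideal R) : SystemOfIdeals R where
  carrier := Set.range (𝔞 ^ · : ℕ → Ideal R)
  nonempty := Set.range_nonempty _
  exists_le_mul := by
    rintro _ ⟨m, rfl⟩ _ ⟨n, rfl⟩
    exact ⟨𝔞 ^ (m + n), ⟨m + n, rfl⟩, (pow_add 𝔞 m n).le⟩

/-- The system of all ideals whose zero locus is contained in a given set of primes. -/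
def ofZeroLocus (T : Set (PrimeSpectrum R)) : SystemOfIdeals R where
  carrier := {𝔞 | PrimeSpectrum.zeroLocus (𝔞 : Set R) ⊆ T}
  nonempty := ⟨⊤, by simp⟩
  exists_le_mul := fun 𝔞 h𝔞 𝔟 h𝔟 =>
    ⟨𝔞 * 𝔟, by
      simp only [Set.mem_ofPred_eq, PrimeSpectrum.zeroLocus_mul] at *
      exact Set.union_subset h𝔞 h𝔟, le_rfl⟩

variable (Φ : SystemOfIdeals R)

theorem exists_le_pow {𝔞 : Ideal R} (h𝔞 : 𝔞 ∈ Φ) (n : ℕ) : ∃ 𝔟 ∈ Φ, 𝔟 ≤ 𝔞 ^ n := by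
  induction n with
  | zero => exact ⟨𝔞, h𝔞, by simp⟩
  | succ n ih =>
    obtain ⟨𝔟, h𝔟, hle⟩ := ih
    obtain ⟨𝔠, h𝔠, hle'⟩ := Φ.exists_le_mul 𝔟 h𝔟 𝔞 h𝔞
    exact ⟨𝔠, h𝔠, hle'.trans (by rw [pow_succ]; exact Ideal.mul_mono_left hle)⟩

theorem torsion_powers_le {𝔞 : Ideal R} (h𝔞 : 𝔞 ∈ Φ) (M : Type u) [AddCommGroup M] [Module R M] :
    (powers 𝔞).torsion M ≤ Φ.torsion M := by
  rintro x ⟨_, ⟨n, rfl⟩, hx⟩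
  obtain ⟨𝔟, h𝔟, hle⟩ := Φ.exists_le_pow h𝔞 n
  exact ⟨𝔟, h𝔟, fun r hr => hx r (hle hr)⟩

/-- A finitely generated submodule of `Γ_Φ(M)` is killed by a single member of `Φ`. -/
theorem exists_smul_eq_zero_of_fg {M : Type u} [AddCommGroup M] [Module R M] {N : Submodule R M}
    (hN : N.FG) (hle : N ≤ Φ.torsion M) : ∃ 𝔞 ∈ Φ, ∀ r ∈ 𝔞, ∀ x ∈ N, r • x = 0 := by
  induction N, hN using Submodule.fg_induction with
  | singleton x =>
    obtain ⟨𝔞, h𝔞, hx⟩ := hle (Submodule.mem_span_singleton_self x)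
    refine ⟨𝔞, h𝔞, fun r hr y hy => ?_⟩
    obtain ⟨s, rfl⟩ := Submodule.mem_span_singleton.1 hy
    rw [smul_comm, hx r hr, smul_zero]
  | sup N₁ N₂ _ _ h₁ h₂ =>
    obtain ⟨𝔞, h𝔞, hx⟩ := h₁ (le_sup_left.trans hle)
    obtain ⟨𝔟, h𝔟, hy⟩ := h₂ (le_sup_right.trans hle)
    obtain ⟨𝔠, h𝔠, hle'⟩ := Φ.exists_le_mul 𝔞 h𝔞 𝔟 h𝔟
    refine ⟨𝔠, h𝔠, fun r hr z hz => ?_⟩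
    obtain ⟨x, hxN, y, hyN, rfl⟩ := Submodule.mem_sup.1 hz
    have hr' := Ideal.mul_le_inf (hle' hr)
    rw [smul_add, hx r hr'.1 x hxN, hy r hr'.2 y hyN, add_zero]

/-- Over a Noetherian ring, the `Φ`-torsion submodule of an injective module is injective. -/
theorem injective_torsion [IsNoetherianRing R] (E : Type u) [AddCommGroup E] [Module R E]
    [Module.Injective R E] : Module.Injective R (Φ.torsion E) := by
  refine Module.Baer.injective fun I g => ?_
  obtain ⟨𝔞, h𝔞, hg⟩ : ∃ 𝔞 ∈ Φ, ∀ r ∈ 𝔞, ∀ x : I, r • g x = 0 := by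
    obtain ⟨𝔞, h𝔞, h⟩ := Φ.exists_smul_eq_zero_of_fg
      (N := LinearMap.range ((Φ.torsion E).subtype ∘ₗ g))
      (by rw [LinearMap.range_eq_map]; exact (Module.Finite.fg_top (R := R) (M := I)).map _)
      (by rintro _ ⟨x, rfl⟩; exact (g x).2)
    exact ⟨𝔞, h𝔞, fun r hr x => Subtype.ext (h r hr _ ⟨x, rfl⟩)⟩
  -- By Artin–Rees, `𝔞 ^ (k + 1) ⊓ I ≤ 𝔞 * I`, which `g` kills. Hence `g` factors through the image
  -- of `I` in `R ⧸ 𝔞 ^ (k + 1)`, and an extension defined on that quotient takes only torsion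
  -- values.
  obtain ⟨k, hk⟩ := Ideal.exists_pow_inf_eq_pow_smul 𝔞 (I : Submodule R R)
  have hle : (𝔞 ^ (k + 1)) ⊓ I ≤ 𝔞 * I := by
    have := hk (k + 1) (by omega)
    simp only [smul_eq_mul, Ideal.mul_top, Nat.add_sub_cancel_left, pow_one] at this
    rw [this]
    exact Ideal.mul_mono_right inf_le_right
  have hker : Submodule.comap I.subtype (𝔞 ^ (k + 1)) ≤
      LinearMap.ker ((Φ.torsion E).subtype ∘ₗ g) := by
    intro x hx
    have hx' : (x : R) ∈ 𝔞 * I := hle ⟨hx, x.2⟩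
    have key : ∀ y ∈ 𝔞 * I, ∃ hy : y ∈ I, g ⟨y, hy⟩ = 0 := fun y hy => by
      refine Submodule.mul_induction_on hy (fun r hr s hs => ?_) ?_
      · exact ⟨I.mul_mem_left r hs, (map_smul g r ⟨s, hs⟩).trans (hg r hr ⟨s, hs⟩)⟩
      · rintro a b ⟨ha, ha'⟩ ⟨hb, hb'⟩
        exact ⟨add_mem ha hb,
          (map_add g (⟨a, ha⟩ : I) ⟨b, hb⟩).trans (by rw [ha', hb', add_zero])⟩
    simp [(key x hx').2]
  let i := Submodule.mapQ (Submodule.comap I.subtype (𝔞 ^ (k + 1))) (𝔞 ^ (k + 1)) I.subtype le_rfl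
  have hi : Function.Injective i := by
    rw [← LinearMap.ker_eq_bot, Submodule.ker_mapQ]
    simp
  obtain ⟨h, hh⟩ := Module.Injective.out i hi (Submodule.liftQ _ _ hker)
  obtain ⟨𝔟, h𝔟, hle'⟩ := Φ.exists_le_pow h𝔞 (k + 1)
  refine ⟨LinearMap.codRestrict _ (h ∘ₗ Submodule.mkQ (𝔞 ^ (k + 1)))
    fun x => ⟨𝔟, h𝔟, fun r hr => ?_⟩, fun x hx => Subtype.ext ?_⟩
  · rw [← map_smul, LinearMap.comp_apply, Submodule.mkQ_apply,
      (Submodule.Quotient.mk_eq_zero _).2, map_zero]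
    exact Ideal.mul_mem_right _ _ (hle' hr)
  · exact hh (Submodule.Quotient.mk ⟨x, hx⟩)

end SystemOfIdeals

namespace Module.Injective

variable {R : Type u} [Ring R]

theorem of_retract {E J : Type u} [AddCommGroup E] [Module R E] [AddCommGroup J] [Module R J]
    [Module.Injective R E] (i : J →ₗ[R] E) (p : E →ₗ[R] J) (h : ∀ x, p (i x) = x) :
    Module.Injective R J where
  out X Y _ _ _ _ f hf g := by
    obtain ⟨l, hl⟩ := Module.Injective.out f hf (i ∘ₗ g)
    exact ⟨p ∘ₗ l, fun x => by simp [hl, h]⟩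

theorem prod {E J : Type u} [AddCommGroup E] [Module R E] [AddCommGroup J] [Module R J]
    [Module.Injective R E] [Module.Injective R J] : Module.Injective R (E × J) where
  out X Y _ _ _ _ f hf g := by
    obtain ⟨l, hl⟩ := Module.Injective.out f hf (LinearMap.fst R E J ∘ₗ g)
    obtain ⟨m, hm⟩ := Module.Injective.out f hf (LinearMap.snd R E J ∘ₗ g)
    exact ⟨l.prod m, fun x => Prod.ext (hl x) (hm x)⟩

end Module.Injective

/-- The class of modules whose support is contained in a given set of primes. -/
def supportIn {R : Type u} [CommRing R] (T : Set (PrimeSpectrum R)) :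
    ObjectProperty (ModuleCat.{u} R) :=
  fun N => Module.support R N ⊆ T

/-! ### Classes of modules defined by their support -/

section SupportIn

variable {R : Type u} [CommRing R] {T : Set (PrimeSpectrum R)}

theorem supportIn_iff {N : ModuleCat.{u} R} :
    supportIn T N ↔ ∀ p ∉ T, ∀ x : N, ∃ r ∉ p.asIdeal, r • x = 0 := by
  simp only [supportIn, Set.subset_def, ← Module.notMem_support_iff']
  exact forall_congr' fun p => not_imp_not.symm

theorem supportIn_of_injective {M N : ModuleCat.{u} R} (f : M →ₗ[R] N)
    (hf : Function.Injective f) (h : supportIn T N) : supportIn T M :=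
  (Module.support_subset_of_injective f hf).trans h

theorem supportIn_of_surjective {M N : ModuleCat.{u} R} (f : M →ₗ[R] N)
    (hf : Function.Surjective f) (h : supportIn T M) : supportIn T N :=
  (Module.support_subset_of_surjective f hf).trans h

theorem supportIn_congr {M N : ModuleCat.{u} R} (e : M ≅ N) : supportIn T M ↔ supportIn T N := by
  rw [supportIn, supportIn, e.toLinearEquiv.support_eq]

theorem supportIn_of_exact {S : ShortComplex (ModuleCat.{u} R)} (hS : S.Exact)
    (h₁ : supportIn T S.X₁) (h₃ : supportIn T S.X₃) : supportIn T S.X₂ := by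
  rw [supportIn_iff] at *
  intro p hp x
  obtain ⟨r, hr, hrx⟩ := h₃ p hp (S.g.hom x)
  rw [← map_smul] at hrx
  obtain ⟨y, hy⟩ := (ShortComplex.moduleCat_exact_iff S).1 hS _ hrx
  obtain ⟨s, hs, hsy⟩ := h₁ p hp y
  refine ⟨s * r, p.isPrime.mul_notMem hs hr, ?_⟩
  rw [mul_smul, ← hy, ← map_smul, hsy, map_zero]

/-- If `A ⟶ B ⟶ C ⟶ 0` is exact and `A` has support in `T`, then `B` has support in `T`
if and only if `C` does. -/
theorem supportIn_iff_of_exact_of_epi {S : ShortComplex (ModuleCat.{u} R)} (hS : S.Exact)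
    (hg : Epi S.g) (h₁ : supportIn T S.X₁) : supportIn T S.X₂ ↔ supportIn T S.X₃ :=
  ⟨supportIn_of_surjective S.g.hom ((ModuleCat.epi_iff_surjective _).1 hg),
    supportIn_of_exact hS h₁⟩

open SystemOfIdeals in
theorem exists_notMem_smul_eq_zero_of_mem_torsion_ofZeroLocus {M : Type u} [AddCommGroup M]
    [Module R M] {x : M} (hx : x ∈ (ofZeroLocus T).torsion M) {p : PrimeSpectrum R} (hp : p ∉ T) :
    ∃ r ∉ p.asIdeal, r • x = 0 := by
  obtain ⟨𝔞, h𝔞, h⟩ := hx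
  obtain ⟨r, hr, hrp⟩ := Set.not_subset.1 fun hle =>
    hp (h𝔞 ((PrimeSpectrum.mem_zeroLocus _ _).2 hle))
  exact ⟨r, hrp, h r hr⟩

open SystemOfIdeals in
theorem mem_torsion_ofZeroLocus {M : Type u} [AddCommGroup M] [Module R M] {x : M}
    (h : ∀ p ∉ T, ∃ r ∉ p.asIdeal, r • x = 0) : x ∈ (ofZeroLocus T).torsion M := by
  refine ⟨LinearMap.ker (LinearMap.toSpanSingleton R M x), fun p hp => ?_, fun r hr => hr⟩
  by_contra hpT
  obtain ⟨r, hr, hrx⟩ := h p hpT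
  exact hr (hp hrx)

/-- An element of `Γ_Φ(M)` already lies in some `Γ_𝔞(M)`, and support is tested on single elements.
This is the degree 0 case of the comparison. -/
theorem supportIn_torsion_iff (Φ : SystemOfIdeals R) (M : ModuleCat.{u} R) :
    supportIn T (Φ.torsionFunctor.obj M) ↔
      ∀ 𝔞 ∈ Φ, supportIn T ((SystemOfIdeals.powers 𝔞).torsionFunctor.obj M) := by
  refine ⟨fun h 𝔞 h𝔞 => supportIn_of_injective (Submodule.inclusion (Φ.torsion_powers_le h𝔞 M))
    (Submodule.inclusion_injective _) h, fun h => supportIn_iff.2 ?_⟩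
  rintro p hp ⟨x, 𝔞, h𝔞, hx⟩
  obtain ⟨r, hr, hrx⟩ := supportIn_iff.1 (h 𝔞 h𝔞) p hp
    ⟨x, 𝔞, ⟨1, pow_one 𝔞⟩, hx⟩
  have hrx' : r • x = 0 := Subtype.ext_iff.1 hrx
  exact ⟨r, hr, Subtype.ext hrx'⟩

/-- If `Γ_Φ(M)` has support in `T`, then `M` embeds in an injective module `E` such that
`Γ_Φ(E)` has support in `T`. -/
theorem exists_mono_injective_supportIn_torsion [IsNoetherianRing R] (Φ : SystemOfIdeals R)
    (M : ModuleCat.{u} R) (h : supportIn T (Φ.torsionFunctor.obj M)) :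
    ∃ (E : ModuleCat.{u} R) (f : M ⟶ E), Injective E ∧ Mono f ∧
      supportIn T (Φ.torsionFunctor.obj E) := by
  let E₀ : ModuleCat.{u} R := Injective.under M
  let j : M →ₗ[R] E₀ := (Injective.ι M).hom
  have hj : Function.Injective j := (ModuleCat.mono_iff_injective _).1 (Injective.ι_mono M)
  have : Module.Injective R E₀ :=
    (Module.injective_iff_injective_object R E₀).2 (Injective.injective_under M)
  let Ψ := SystemOfIdeals.ofZeroLocus T
  have hΨ := Ψ.injective_torsion E₀
  have hΦ := Φ.injective_torsion E₀
  obtain ⟨q, hq⟩ := hΨ.out (Ψ.torsion E₀).subtype Subtype.val_injective LinearMap.id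
  obtain ⟨ρ, hρ⟩ := hΦ.out (Φ.torsion E₀).subtype Subtype.val_injective LinearMap.id
  -- The complement `ker ρ` of `Γ_Φ(E₀)` has no `Φ`-torsion. The part `Γ_Φ(E₀)`, possibly too large,
  -- is replaced by `Γ_Ψ(E₀)`, whose support lies in `T`.
  let π : E₀ →ₗ[R] LinearMap.ker ρ := LinearMap.codRestrict _
    (LinearMap.id - (Φ.torsion E₀).subtype ∘ₗ ρ) fun x => by
      have := hρ (ρ x)
      simp only [Submodule.subtype_apply, LinearMap.id_apply] at this
      simp [this]
  have hπ (x : E₀) : (π x : E₀) = x - ρ x := rfl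
  have : Module.Injective R (LinearMap.ker ρ) :=
    .of_retract (LinearMap.ker ρ).subtype π fun x => Subtype.ext <| by
      rw [hπ, Submodule.subtype_apply, LinearMap.mem_ker.1 x.2]; simp
  have := Module.Injective.prod (R := R) (E := Ψ.torsion E₀) (J := LinearMap.ker ρ)
  refine ⟨ModuleCat.of R (Ψ.torsion E₀ × LinearMap.ker ρ), ModuleCat.ofHom ((q.prod π) ∘ₗ j),
    (Module.injective_iff_injective_object R _).1 this, (ModuleCat.mono_iff_injective _).2 ?_,
    supportIn_iff.2 ?_⟩
  · refine (injective_iff_map_eq_zero ((q.prod π) ∘ₗ j)).2 fun x hx => ?_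
    have hqx : q (j x) = 0 := congrArg Prod.fst hx
    have hπx : j x - ρ (j x) = 0 := congrArg (fun y => ((Prod.snd y : LinearMap.ker ρ) : E₀)) hx
    -- The kernel of `π` is `Γ_Φ(E₀)`, so `x` is `Φ`-torsion. By hypothesis it is then supported in
    -- `T`, so `j x` lies in `Γ_Ψ(E₀)`, where `q` is the identity.
    have hxΦ : x ∈ Φ.torsion M := by
      obtain ⟨𝔞, h𝔞, ha⟩ : j x ∈ Φ.torsion E₀ := by rw [sub_eq_zero.1 hπx]; exact (ρ (j x)).2
      exact ⟨𝔞, h𝔞, fun r hr => hj (by rw [map_smul, ha r hr, map_zero])⟩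
    have hxΨ : j x ∈ Ψ.torsion E₀ := mem_torsion_ofZeroLocus fun p hp => by
      obtain ⟨r, hr, hrx⟩ := supportIn_iff.1 h p hp ⟨x, hxΦ⟩
      have hrx' : r • x = 0 := Subtype.ext_iff.1 hrx
      exact ⟨r, hr, by rw [← map_smul, hrx', map_zero]⟩
    have : (⟨j x, hxΨ⟩ : Ψ.torsion E₀) = 0 := (hq ⟨j x, hxΨ⟩).symm.trans hqx
    exact hj (by rw [map_zero]; exact congrArg Subtype.val this)
  · rintro p hp ⟨⟨x, y⟩, 𝔞, h𝔞, hxy⟩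
    obtain ⟨r, hr, hrx⟩ := exists_notMem_smul_eq_zero_of_mem_torsion_ofZeroLocus x.2 hp
    have hy : (y : E₀) ∈ Φ.torsion E₀ :=
      ⟨𝔞, h𝔞, fun r hr => congrArg (fun z => ((Prod.snd z : LinearMap.ker ρ) : E₀)) (hxy r hr)⟩
    have hy0 : y = 0 := by
      have h1 := hρ ⟨y, hy⟩
      rw [Submodule.subtype_apply, LinearMap.mem_ker.1 y.2] at h1
      exact Subtype.ext (congrArg Subtype.val h1).symm
    refine ⟨r, hr, Subtype.ext (Prod.ext (Subtype.ext hrx) ?_)⟩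
    change r • y = 0
    rw [hy0, smul_zero]

end SupportIn

/-! ### Dimension as a condition on the support -/

section Dimension

variable {R : Type u} [CommRing R]

/-- The support is closed under specialization, so every chain of primes above a member stays inside
it. -/
theorem supportDim_le_iff_coheight_le {N : Type u} [AddCommGroup N] [Module R N] (n : ℕ) :
    Module.supportDim R N ≤ n ↔ ∀ p ∈ Module.support R N, Order.coheight p ≤ n := by
  constructor
  · intro h p hp
    have h1 : (Order.coheight p : WithBot ℕ∞) ≤ Module.supportDim R N := by
      rw [Order.coheight_eq_krullDim_Ici]
      exact Order.krullDim_le_of_strictMono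
        (fun a => ⟨a.1, Module.mem_support_mono a.2 hp⟩) fun _ _ hlt => hlt
    exact_mod_cast h1.trans h
  · intro h
    rw [Module.supportDim, Order.krullDim_eq_iSup_coheight]
    refine iSup_le fun a => ?_
    exact_mod_cast (Order.coheight_le_coheight_apply_of_strictMono Subtype.val
      (fun _ _ hlt => hlt) a).trans (h a a.2)

/-- For `k ≥ -1`, having dimension at most `k` is a condition on the support. -/
theorem exists_dimLE_iff_supportIn {k : ℤ} (hk : -1 ≤ k) :
    ∃ T : Set (PrimeSpectrum R), ∀ N : ModuleCat.{u} R, dimLE R k N ↔ supportIn T N := by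
  obtain rfl | ⟨n, rfl⟩ : k = -1 ∨ ∃ n : ℕ, k = n := by
    rcases hk.eq_or_lt with h | h
    · exact .inl h.symm
    · exact .inr ⟨k.toNat, by omega⟩
  -- Dimension at most `-1` means `N = 0`, that is, empty support.
  · refine ⟨∅, fun N => ?_⟩
    rw [supportIn, Set.subset_empty_iff, Module.support_eq_empty_iff,
      ← Module.supportDim_eq_bot_iff_subsingleton R, dimLE, moduleDim]
    rcases Module.supportDim R N with _ | _ | n
    · exact ⟨fun _ => rfl, fun _ => le_rfl⟩
    · exact ⟨fun h => absurd (top_le_iff.1 h) (WithTop.coe_ne_top), fun h => nomatch h⟩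
    · exact ⟨fun h => absurd (WithTop.coe_le_coe.1 h) (by dsimp only; omega), fun h => nomatch h⟩
  · refine ⟨{p | Order.coheight p ≤ n}, fun N => ?_⟩
    refine Iff.trans ?_ (supportDim_le_iff_coheight_le n)
    rw [dimLE, moduleDim]
    rcases Module.supportDim R N with _ | _ | m
    · exact ⟨fun _ => bot_le, fun _ => WithTop.coe_le_coe.2 (by omega)⟩
    · exact ⟨fun h => absurd (top_le_iff.1 h) WithTop.coe_ne_top,
        fun h => absurd (top_le_iff.1 (WithBot.coe_le_coe.1 h)) (ENat.natCast_ne_top n)⟩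
    · refine WithTop.coe_le_coe.trans (Nat.cast_le.trans ?_)
      exact (Nat.cast_le (α := ℕ∞)).symm.trans WithBot.coe_le_coe.symm

theorem not_dimLE_of_lt {k : ℤ} (hk : k < -1) (N : ModuleCat.{u} R) : ¬ dimLE R k N := by
  rw [dimLE, moduleDim]
  rcases Module.supportDim R N with _ | _ | n
  · exact fun h => absurd (WithTop.coe_le_coe.1 h) (by omega)
  · exact fun h => absurd (top_le_iff.1 h) WithTop.coe_ne_top
  · exact fun h => absurd (WithTop.coe_le_coe.1 h) (by dsimp only; omega)

end Dimension

/-! ### Dimension shifting for right derived functors -/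

namespace CategoryTheory

open Limits

variable {C D : Type*} [Category* C] [Category* D] [Abelian C] [Abelian D]

namespace InjectiveResolution

variable {S : ShortComplex C} (hS : S.ShortExact)
  (J : InjectiveResolution S.X₃)

/-- The first map `X ⟶ J⁰` of an injective resolution. -/
def ιZero {X : C} (J : InjectiveResolution X) : X ⟶ J.cocomplex.X 0 := J.ι.f 0

instance {X : C} (J : InjectiveResolution X) : Mono J.ιZero :=
  inferInstanceAs (Mono (J.ι.f 0))

theorem ιZero_d {X : C} (J : InjectiveResolution X) : J.ιZero ≫ J.cocomplex.d 0 1 = 0 :=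
  J.ι_f_zero_comp_complex_d

theorem exact_ιZero {X : C} (J : InjectiveResolution X) :
    (ShortComplex.mk J.ιZero (J.cocomplex.d 0 1) J.ιZero_d).Exact := J.exact₀

/-- The cochain complex `X₂ ⟶ J⁰ ⟶ J¹ ⟶ ⋯`. -/
noncomputable def spliceCocomplex : CochainComplex C ℕ :=
  J.cocomplex.augment (S.g ≫ J.ιZero) (by rw [Category.assoc, ιZero_d, comp_zero])

include hS in
theorem exact_splice_zero : (ShortComplex.mk S.f (S.g ≫ J.ιZero)
    (by rw [S.zero_assoc, zero_comp])).Exact := by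
  let α : S ⟶ ShortComplex.mk S.f (S.g ≫ J.ιZero) (by rw [S.zero_assoc, zero_comp]) :=
    { τ₁ := 𝟙 _, τ₂ := 𝟙 _, τ₃ := J.ιZero }
  have : Mono α.τ₃ := inferInstanceAs (Mono J.ιZero)
  have : IsIso α.τ₂ := inferInstanceAs (IsIso (𝟙 _))
  have : Epi α.τ₁ := inferInstanceAs (Epi (𝟙 _))
  exact (ShortComplex.exact_iff_of_epi_of_isIso_of_mono α).1 hS.exact

include hS in
theorem exact_splice_one : (ShortComplex.mk (S.g ≫ J.ιZero) (J.cocomplex.d 0 1)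
    (by rw [Category.assoc, ιZero_d, comp_zero])).Exact := by
  let α : ShortComplex.mk (S.g ≫ J.ιZero) (J.cocomplex.d 0 1)
      (by rw [Category.assoc, ιZero_d, comp_zero]) ⟶
      ShortComplex.mk J.ιZero (J.cocomplex.d 0 1) J.ιZero_d :=
    { τ₁ := S.g, τ₂ := 𝟙 _, τ₃ := 𝟙 _ }
  have : Epi α.τ₁ := hS.epi_g
  have : IsIso α.τ₂ := inferInstanceAs (IsIso (𝟙 _))
  have : Mono α.τ₃ := inferInstanceAs (Mono (𝟙 _))
  exact (ShortComplex.exact_iff_of_epi_of_isIso_of_mono α).2 J.exact_ιZero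

include hS in
theorem spliceCocomplex_exactAt_succ (n : ℕ) : (spliceCocomplex J).ExactAt (n + 1) := by
  rw [HomologicalComplex.exactAt_iff' _ n (n + 1) (n + 2) (by simp) (by simp)]
  match n with
  | 0 => exact exact_splice_one hS J
  | n + 1 => exact J.exact_succ n

/-- Given a short exact sequence `0 ⟶ X₁ ⟶ X₂ ⟶ X₃ ⟶ 0` with `X₂` injective and an injective
resolution `J` of `X₃`, the injective resolution `X₂ ⟶ J⁰ ⟶ J¹ ⟶ ⋯` of `X₁`. -/
noncomputable def splice [Injective S.X₂] : InjectiveResolution S.X₁ where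
  cocomplex := spliceCocomplex J
  injective n := match n with
    | 0 => inferInstanceAs (Injective S.X₂)
    | n + 1 => J.injective n
  ι := (CochainComplex.fromSingle₀Equiv _ _).symm ⟨S.f,
    show S.f ≫ S.g ≫ J.ιZero = 0 by rw [S.zero_assoc, zero_comp]⟩
  quasiIso := ⟨fun n => by
    cases n
    -- In degree 0 the claim is exactness of `0 ⟶ X₁ ⟶ X₂ ⟶ J⁰`.
    · rw [CochainComplex.quasiIsoAt₀_iff, ShortComplex.quasiIso_iff_of_zeros]
      · refine (ShortComplex.exact_and_mono_f_iff_of_iso ?_).2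
          ⟨exact_splice_zero hS J, hS.mono_f⟩
        exact ShortComplex.isoMk (Iso.refl _) (Iso.refl _) (Iso.refl _)
          (by
            refine (Category.id_comp S.f).trans (Eq.trans ?_ (Category.comp_id _).symm)
            exact (CochainComplex.fromSingle₀Equiv_symm_apply_f_zero
              (C := spliceCocomplex J) (X := S.X₁) S.f _).symm)
          ((Category.id_comp (S.g ≫ J.ιZero)).trans (Category.comp_id (S.g ≫ J.ιZero)).symm)
      all_goals rfl
    · rw [quasiIsoAt_iff_exactAt]
      · exact spliceCocomplex_exactAt_succ hS J _
      · apply CochainComplex.exactAt_succ_single_obj⟩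

end InjectiveResolution

namespace Functor

variable [HasInjectiveResolutions C] (F : C ⥤ D) [F.Additive]
  {S : ShortComplex C} (hS : S.ShortExact) [Injective S.X₂]

include hS in
/-- Dimension shifting for right derived functors. -/
theorem nonempty_rightDerived_succ_succ_iso (n : ℕ) :
    Nonempty ((F.rightDerived (n + 2)).obj S.X₁ ≅ (F.rightDerived (n + 1)).obj S.X₃) := by
  let J := injectiveResolution S.X₃
  let K := (F.mapHomologicalComplex (ComplexShape.up ℕ)).obj J.cocomplex
  let K' := (F.mapHomologicalComplex (ComplexShape.up ℕ)).obj (J.splice hS).cocomplex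
  -- From degree 1 on, the spliced complex is `J` shifted by one, so the two pieces agree
  -- definitionally. The middle degree `n + 1` of `K` is positive, so the new term `X₂` does not
  -- enter.
  let e : K'.sc' (n + 1) (n + 2) (n + 3) ≅ K.sc' n (n + 1) (n + 2) := Iso.refl _
  exact ⟨(J.splice hS).isoRightDerivedObj F (n + 2) ≪≫
    ShortComplex.homologyMapIso (K'.isoSc' (n + 1) (n + 2) (n + 3) (by simp) (by simp)) ≪≫
    ShortComplex.homologyMapIso e ≪≫
    (ShortComplex.homologyMapIso (K.isoSc' n (n + 1) (n + 2) (by simp) (by simp))).symm ≪≫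
    (J.isoRightDerivedObj F (n + 1)).symm⟩

include hS in
/-- If `0 ⟶ X₁ ⟶ X₂ ⟶ X₃ ⟶ 0` is exact with `X₂` injective and `F` is left exact, then
`F X₂ ⟶ F X₃ ⟶ R¹F X₁ ⟶ 0` is exact. -/
theorem exists_exact_rightDerived_one [PreservesFiniteLimits F] :
    ∃ (p : F.obj S.X₃ ⟶ (F.rightDerived 1).obj S.X₁) (w : F.map S.g ≫ p = 0),
      Epi p ∧ (ShortComplex.mk (F.map S.g) p w).Exact := by
  let J := injectiveResolution S.X₃
  let K' := (F.mapHomologicalComplex (ComplexShape.up ℕ)).obj (J.splice hS).cocomplex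
  let A : ShortComplex D := ShortComplex.mk (F.map (S.g ≫ J.ιZero)) (F.map (J.cocomplex.d 0 1))
    (by rw [← F.map_comp, Category.assoc, J.ιZero_d, comp_zero, F.map_zero])
  let eA : K'.sc' 0 1 2 ≅ A := Iso.refl _
  let e : A.homology ≅ (F.rightDerived 1).obj S.X₁ :=
    ShortComplex.homologyMapIso eA.symm ≪≫
    (ShortComplex.homologyMapIso (K'.isoSc' 0 1 2 (by simp) (by simp))).symm ≪≫
    ((J.splice hS).isoRightDerivedObj F 1).symm
  have hex : (ShortComplex.mk (F.map J.ιZero) (F.map (J.cocomplex.d 0 1))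
      (by rw [← F.map_comp, J.ιZero_d, F.map_zero])).Exact :=
    J.exact_ιZero.map_of_mono_of_preservesKernel F inferInstance inferInstance
  have : Mono (F.map J.ιZero) := inferInstance
  -- Left exactness makes `F X₃` the kernel of `F J⁰ ⟶ F J¹`, that is, the cycles of `A`. So `R¹F
  -- X₁` is the cokernel of `F X₂ ⟶ F X₃`.
  let c : F.obj S.X₃ ⟶ A.cycles := A.liftCycles (F.map J.ιZero)
    (by dsimp [A]; rw [← F.map_comp, J.ιZero_d, F.map_zero])
  have hc : IsIso c := by
    let l := hex.lift A.iCycles A.iCycles_g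
    have hl : l ≫ F.map J.ιZero = A.iCycles := hex.lift_f _ _
    refine ⟨l, ?_, ?_⟩
    · rw [← cancel_mono (F.map J.ιZero)]
      simp [hl, c]
    · rw [← cancel_mono A.iCycles]
      simp [hl, c]
  have hgc : F.map S.g ≫ c = A.toCycles := by
    rw [← cancel_mono A.iCycles]
    simp [c, A]
  refine ⟨c ≫ A.homologyπ ≫ e.hom, by rw [reassoc_of% hgc]; simp, inferInstance, ?_⟩
  have hA : (ShortComplex.mk A.toCycles A.homologyπ A.toCycles_comp_homologyπ).Exact :=
    ShortComplex.exact_of_g_is_cokernel _ A.homologyIsCokernel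
  refine (ShortComplex.exact_iff_of_iso ?_).2 hA
  refine ShortComplex.isoMk (Iso.refl _) (asIso c) e.symm ?_ ?_
  · exact (Category.id_comp _).trans hgc.symm
  · simp

end Functor

end CategoryTheory

/-! ### Connecting morphisms for short exact sequences of functors -/

namespace CategoryTheory

open Limits

variable {C D : Type*} [Category* C] [Category* D] [Abelian C] [Abelian D]

namespace Functor

variable {F₁ F₂ F₃ : C ⥤ D} [F₁.Additive] [F₂.Additive] [F₃.Additive]
  {α : F₁ ⟶ F₂} {β : F₂ ⟶ F₃} (w : α ≫ β = 0)

/-- The short complex of chain complexes `F₁(K) ⟶ F₂(K) ⟶ F₃(K)`. -/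
@[simps]
noncomputable def mapChainComplexShortComplex (K : ChainComplex C ℕ) :
    ShortComplex (ChainComplex D ℕ) where
  X₁ := (F₁.mapHomologicalComplex _).obj K
  X₂ := (F₂.mapHomologicalComplex _).obj K
  X₃ := (F₃.mapHomologicalComplex _).obj K
  f := (NatTrans.mapHomologicalComplex α _).app K
  g := (NatTrans.mapHomologicalComplex β _).app K
  zero := by
    ext i
    exact congr_app w (K.X i)

/-- The morphism of short complexes of chain complexes induced by a chain map. -/
@[simps]
noncomputable def mapChainComplexShortComplexMap {K L : ChainComplex C ℕ} (φ : K ⟶ L) :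
    mapChainComplexShortComplex w K ⟶ mapChainComplexShortComplex w L where
  τ₁ := (F₁.mapHomologicalComplex _).map φ
  τ₂ := (F₂.mapHomologicalComplex _).map φ
  τ₃ := (F₃.mapHomologicalComplex _).map φ
  comm₁₂ := (NatTrans.mapHomologicalComplex α _).naturality φ
  comm₂₃ := (NatTrans.mapHomologicalComplex β _).naturality φ

variable (h : ∀ (P : C) [Projective P],
  (ShortComplex.mk (α.app P) (β.app P) (congr_app w P)).ShortExact)

include h in
theorem shortExact_mapChainComplexShortComplex {X : C} (P : ProjectiveResolution X) :
    (mapChainComplexShortComplex w P.complex).ShortExact :=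
  HomologicalComplex.shortExact_of_degreewise_shortExact _ fun i => h (P.complex.X i)

/-- The connecting morphism `Hₙ₊₁(F₃(P)) ⟶ Hₙ(F₁(P))` for a projective resolution `P`. -/
noncomputable def projectiveResolutionδ {X : C} (P : ProjectiveResolution X) (n : ℕ) :
    (HomologicalComplex.homologyFunctor D _ (n + 1)).obj
        ((F₃.mapHomologicalComplex (ComplexShape.down ℕ)).obj P.complex) ⟶
      (HomologicalComplex.homologyFunctor D _ n).obj
        ((F₁.mapHomologicalComplex (ComplexShape.down ℕ)).obj P.complex) :=
  (shortExact_mapChainComplexShortComplex w h P).δ (n + 1) n (by simp)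

theorem projectiveResolutionδ_naturality {X Y : C} (P : ProjectiveResolution X)
    (Q : ProjectiveResolution Y) (φ : P.complex ⟶ Q.complex) (n : ℕ) :
    projectiveResolutionδ w h P n ≫
        (F₁.mapHomologicalComplex _ ⋙ HomologicalComplex.homologyFunctor _ _ n).map φ =
      (F₃.mapHomologicalComplex _ ⋙ HomologicalComplex.homologyFunctor _ _ (n + 1)).map φ ≫
        projectiveResolutionδ w h Q n :=
  HomologicalComplex.HomologySequence.δ_naturality (mapChainComplexShortComplexMap w φ)
    (shortExact_mapChainComplexShortComplex w h P)
    (shortExact_mapChainComplexShortComplex w h Q) (n + 1) n (by simp)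

theorem projectiveResolutionδ_comp {X : C} (P : ProjectiveResolution X) (n : ℕ) :
    projectiveResolutionδ w h P n ≫ (HomologicalComplex.homologyFunctor D _ n).map
      ((NatTrans.mapHomologicalComplex α (ComplexShape.down ℕ)).app P.complex) = 0 :=
  (shortExact_mapChainComplexShortComplex w h P).δ_comp (n + 1) n (by simp)

theorem exact_projectiveResolutionδ {X : C} (P : ProjectiveResolution X) (n : ℕ) :
    (ShortComplex.mk _ _ (projectiveResolutionδ_comp w h P n)).Exact :=
  (shortExact_mapChainComplexShortComplex w h P).homology_exact₁ (n + 1) n (by simp)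

variable [HasProjectiveResolutions C]

/-- The connecting morphism of left derived functors attached to a sequence of functors
`F₁ ⟶ F₂ ⟶ F₃` which is short exact on projective objects. -/
noncomputable def leftDerivedδ (n : ℕ) : F₃.leftDerived (n + 1) ⟶ F₁.leftDerived n where
  app X := ((projectiveResolution X).isoLeftDerivedObj F₃ (n + 1)).hom ≫
    projectiveResolutionδ w h (projectiveResolution X) n ≫
    ((projectiveResolution X).isoLeftDerivedObj F₁ n).inv
  naturality X Y f := by
    let φ := ProjectiveResolution.lift f (projectiveResolution X) (projectiveResolution Y)
    have hφ := ProjectiveResolution.lift_commutes_zero f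
      (projectiveResolution X) (projectiveResolution Y)
    have h₁ := ProjectiveResolution.isoLeftDerivedObj_inv_naturality f _ _ φ hφ F₁ n
    have h₃ := ProjectiveResolution.isoLeftDerivedObj_hom_naturality f _ _ φ hφ F₃ (n + 1)
    rw [Category.assoc, Category.assoc, h₁, reassoc_of% h₃,
      ← reassoc_of% projectiveResolutionδ_naturality w h _ _ φ n]
    rfl

theorem leftDerivedδ_comp (n : ℕ) (X : C) :
    (leftDerivedδ w h n).app X ≫ (NatTrans.leftDerived α n).app X = 0 := by
  rw [(projectiveResolution X).leftDerived_app_eq α n]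
  simp only [leftDerivedδ, Category.assoc, Iso.inv_hom_id_assoc]
  rw [reassoc_of% projectiveResolutionδ_comp w h (projectiveResolution X) n]
  simp

theorem exact_leftDerivedδ (n : ℕ) (X : C) :
    (ShortComplex.mk _ _ (leftDerivedδ_comp w h n X)).Exact := by
  let P := projectiveResolution X
  refine (ShortComplex.exact_iff_of_iso ?_).2 (exact_projectiveResolutionδ w h P n)
  refine ShortComplex.isoMk (P.isoLeftDerivedObj F₃ (n + 1)) (P.isoLeftDerivedObj F₁ n)
    (P.isoLeftDerivedObj F₂ n) ?_ ?_
  · simp [leftDerivedδ, P]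
  · simp only [P.leftDerived_app_eq α n, Category.assoc, Iso.inv_hom_id, Category.comp_id]

/-- The kernel of the connecting morphism is the image of the vanishing term from `F₂`. -/
theorem mono_leftDerivedδ (n : ℕ) (X : C) (hX : IsZero ((F₂.leftDerived (n + 1)).obj X)) :
    Mono ((leftDerivedδ w h n).app X) := by
  have : Mono (projectiveResolutionδ w h (projectiveResolution X) n) :=
    (shortExact_mapChainComplexShortComplex w h _).mono_δ _ _ _
      (hX.of_iso ((projectiveResolution X).isoLeftDerivedObj F₂ (n + 1)).symm)
  dsimp only [leftDerivedδ]
  infer_instance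

theorem isIso_leftDerivedδ (n : ℕ) (X : C) (hX : IsZero ((F₂.leftDerived (n + 1)).obj X))
    (hX' : IsZero ((F₂.leftDerived n).obj X)) : IsIso ((leftDerivedδ w h n).app X) := by
  have := mono_leftDerivedδ w h n X hX
  have : Epi ((leftDerivedδ w h n).app X) :=
    (exact_leftDerivedδ w h n X).epi_f (hX'.eq_of_tgt _ _)
  exact isIso_of_mono_of_epi _

end Functor

end CategoryTheory

/-! ### Left exactness of the torsion functor -/

namespace SystemOfIdeals

variable {R : Type u} [CommRing R] (Φ : SystemOfIdeals R)

instance : Limits.PreservesFiniteLimits Φ.torsionFunctor := by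
  refine (Φ.torsionFunctor.preservesFiniteLimits_tfae.out 0 3).1 fun S hS => ?_
  have hf : Function.Injective S.f.hom := (ModuleCat.mono_iff_injective _).1 hS.mono_f
  refine ⟨(ShortComplex.moduleCat_exact_iff _).2 ?_, (ModuleCat.mono_iff_injective _).2 ?_⟩
  · rintro ⟨x, 𝔞, h𝔞, hx⟩ hgx
    obtain ⟨y, rfl⟩ := (ShortComplex.moduleCat_exact_iff _).1 hS.exact x (Subtype.ext_iff.1 hgx)
    -- Since `S.f` is injective, an ideal killing the image of `y` kills `y`.
    exact ⟨⟨y, 𝔞, h𝔞, fun r hr => hf (by rw [map_smul, map_zero]; exact hx r hr)⟩, rfl⟩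
  · intro x y hxy
    exact Subtype.ext (hf (Subtype.ext_iff.1 hxy))

end SystemOfIdeals

section

open Opposite Limits

variable {R : Type u} [CommRing R]

/-! ### Exactness of filtered colimits -/

section ColimitExact

variable {J : Type} [SmallCategory J] [IsFiltered J] {T : Set (PrimeSpectrum R)}

instance preservesColimitsOfShape_forget_moduleCat :
    PreservesColimitsOfShape J (forget (ModuleCat.{u} R)) :=
  (preservesSmallestFilteredColimits_of_preservesFilteredColimits
    (forget (ModuleCat.{u} R))).preserves_filtered_colimits J

/-- Filtered colimits of modules are exact. -/
theorem exact_colimMap_of_forall_exact {F G H : J ⥤ ModuleCat.{u} R} (a : F ⟶ G) (b : G ⟶ H)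
    (w : a ≫ b = 0) (hex : ∀ j, (ShortComplex.mk (a.app j) (b.app j) (congr_app w j)).Exact) :
    (ShortComplex.mk (colimMap a) (colimMap b) (by
      refine colimit.hom_ext fun j => ?_
      rw [ι_colimMap_assoc, ι_colimMap, ← NatTrans.comp_app_assoc, w]; simp)).Exact := by
  rw [ShortComplex.moduleCat_exact_iff]
  intro x hx
  obtain ⟨j, y, rfl⟩ := Concrete.colimit_exists_rep G x
  have hy : (colimit.ι H j).hom ((b.app j).hom y) = 0 := by
    rw [← ModuleCat.comp_apply, ← ι_colimMap b j]
    exact hx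
  -- An element that dies in the colimit dies at some stage `k`, where exactness supplies a
  -- preimage.
  obtain ⟨k, i, hk⟩ := Concrete.colimit_rep_eq_zero R H j _ hy
  have hk' : (b.app k).hom ((G.map i).hom y) = 0 := by
    rw [← ModuleCat.comp_apply, b.naturality]
    exact hk
  obtain ⟨z, hz⟩ := (ShortComplex.moduleCat_exact_iff _).1 (hex k) _ hk'
  refine ⟨(colimit.ι F k).hom z, ?_⟩
  change (colimMap a).hom ((colimit.ι F k).hom z) = (colimit.ι G j).hom y
  rw [← ModuleCat.comp_apply, ι_colimMap, ModuleCat.comp_apply]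
  refine (congrArg _ hz).trans ?_
  rw [← ModuleCat.comp_apply, colimit.w]

theorem supportIn_colimit_iff_of_exact_of_epi {F G H : J ⥤ ModuleCat.{u} R} (a : F ⟶ G) (b : G ⟶ H)
    (w : a ≫ b = 0) (hex : ∀ j, (ShortComplex.mk (a.app j) (b.app j) (congr_app w j)).Exact)
    (hb : ∀ j, Epi (b.app j)) (hF : supportIn T (colimit F)) :
    supportIn T (colimit G) ↔ supportIn T (colimit H) := by
  have : Epi b := NatTrans.epi_of_epi_app b
  have : Epi (colimMap b) := inferInstanceAs (Epi (colim.map b))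
  exact supportIn_iff_of_exact_of_epi (exact_colimMap_of_forall_exact a b w hex) this hF

end ColimitExact

/-! ### Ext as a functor of its second argument -/

section Ext

variable {C : Type*} [Category* C] [Abelian C] [Linear R C]

/-- The functor `Hom(-, Y)` with values in `R`-modules, viewed as a covariant functor to the
opposite category. -/
noncomputable abbrev linearYonedaRightOp (R : Type u) [CommRing R] [Linear R C] (Y : C) :
    C ⥤ (ModuleCat R)ᵒᵖ :=
  ((linearYoneda R C).obj Y).rightOp

/-- The natural map `Hom(-, Y) ⟵ Hom(-, X)` in the opposite category induced by `X ⟶ Y`. -/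
noncomputable abbrev linearYonedaRightOpMap (R : Type u) [CommRing R] [Linear R C] {X Y : C}
    (f : X ⟶ Y) : linearYonedaRightOp R Y ⟶ linearYonedaRightOp R X :=
  NatTrans.rightOp ((linearYoneda R C).map f)

theorem linearYonedaRightOpMap_comp {S : ShortComplex C} :
    linearYonedaRightOpMap R S.g ≫ linearYonedaRightOpMap R S.f = 0 := by
  ext X
  refine Quiver.Hom.unop_inj ?_
  ext (φ : X ⟶ S.X₁)
  change (φ ≫ S.f) ≫ S.g = 0
  simp

/-- `Hom(P, -)` is exact for projective `P`; passing to the opposite category reverses the sequence.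
This puts the `Ext` sequence in the second variable within reach of resolutions of the first. -/
theorem shortExact_linearYonedaRightOp {S : ShortComplex C} (hS : S.ShortExact) (P : C)
    [Projective P] :
    (ShortComplex.mk ((linearYonedaRightOpMap R S.g).app P) ((linearYonedaRightOpMap R S.f).app P)
      (congr_app (linearYonedaRightOpMap_comp (R := R)) P)).ShortExact := by
  let A : ShortComplex (ModuleCat R) := ShortComplex.mk
    (((linearYoneda R C).map S.f).app (op P)) (((linearYoneda R C).map S.g).app (op P))
    (by ext (φ : P ⟶ S.X₁); change (φ ≫ S.f) ≫ S.g = 0; simp)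
  have := hS.mono_f
  have := hS.epi_g
  have hA : A.ShortExact :=
    { exact := (ShortComplex.moduleCat_exact_iff _).2 fun (φ : P ⟶ S.X₂) (hφ : φ ≫ S.g = 0) =>
        ⟨hS.exact.lift φ hφ, hS.exact.lift_f φ hφ⟩
      mono_f := (ModuleCat.mono_iff_injective _).2 fun (φ ψ : P ⟶ S.X₁)
        (h : φ ≫ S.f = ψ ≫ S.f) => (cancel_mono S.f).1 h
      epi_g := (ModuleCat.epi_iff_surjective _).2 fun (φ : P ⟶ S.X₃) =>
        ⟨Projective.factorThru φ S.g, Projective.factorThru_comp φ S.g⟩ }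
  exact hA.op

variable [EnoughProjectives C]

/-- The contravariant functor `Extⁿ(-, Y)`. -/
noncomputable abbrev extInto (R : Type u) [CommRing R] [Linear R C] (n : ℕ) (Y : C) :
    Cᵒᵖ ⥤ ModuleCat R :=
  ((linearYonedaRightOp R Y).leftDerived n).leftOp

variable (R) in
theorem isZero_extInto_succ_of_injective (n : ℕ) (X : Cᵒᵖ) (Y : C) [Injective Y] :
    IsZero ((extInto R (n + 1) Y).obj X) := by
  let P := projectiveResolution X.unop
  refine IsZero.of_iso ?_ (P.isoExt (R := R) (n + 1) Y)
  rw [← HomologicalComplex.exactAt_iff_isZero_homology,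
    HomologicalComplex.exactAt_iff' _ n (n + 1) (n + 2) (by simp) (by simp),
    ShortComplex.moduleCat_exact_iff]
  intro (f : P.complex.X (n + 1) ⟶ Y) (hf : P.complex.d (n + 2) (n + 1) ≫ f = 0)
  exact ⟨(P.exact_succ n).descToInjective f hf, (P.exact_succ n).comp_descToInjective f hf⟩

/-- The connecting morphism `Extⁿ(-, X₃) ⟶ Extⁿ⁺¹(-, X₁)` of a short exact sequence. -/
noncomputable def extIntoδ {S : ShortComplex C} (hS : S.ShortExact) (n : ℕ) :
    extInto R n S.X₃ ⟶ extInto R (n + 1) S.X₁ :=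
  NatTrans.leftOp (Functor.leftDerivedδ linearYonedaRightOpMap_comp
    (fun P _ => shortExact_linearYonedaRightOp hS P) n)

/-- The natural map `Extⁿ(-, X) ⟶ Extⁿ(-, Y)` induced by `X ⟶ Y`. -/
noncomputable def extIntoMap {X Y : C} (f : X ⟶ Y) (n : ℕ) : extInto R n X ⟶ extInto R n Y :=
  NatTrans.leftOp (NatTrans.leftDerived (linearYonedaRightOpMap R f) n)

theorem extIntoMap_comp_extIntoδ {S : ShortComplex C} (hS : S.ShortExact) (n : ℕ) :
    extIntoMap (R := R) S.g n ≫ extIntoδ hS n = 0 := by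
  ext X : 2
  exact congrArg Quiver.Hom.unop (Functor.leftDerivedδ_comp linearYonedaRightOpMap_comp
    (fun P _ => shortExact_linearYonedaRightOp hS P) n X.unop)

theorem exact_extIntoδ {S : ShortComplex C} (hS : S.ShortExact) (n : ℕ) (X : Cᵒᵖ) :
    (ShortComplex.mk ((extIntoMap (R := R) S.g n).app X) ((extIntoδ hS n).app X)
      (congr_app (extIntoMap_comp_extIntoδ hS n) X)).Exact :=
  (Functor.exact_leftDerivedδ linearYonedaRightOpMap_comp
    (fun P _ => shortExact_linearYonedaRightOp hS P) n X.unop).unop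

theorem epi_extIntoδ {S : ShortComplex C} (hS : S.ShortExact) [Injective S.X₂] (n : ℕ)
    (X : Cᵒᵖ) : Epi ((extIntoδ (R := R) hS n).app X) := by
  have := Functor.mono_leftDerivedδ linearYonedaRightOpMap_comp
    (fun P _ => shortExact_linearYonedaRightOp (R := R) hS P) n X.unop
    (isZero_extInto_succ_of_injective R n X S.X₂).op
  exact unop_epi_of_mono ((Functor.leftDerivedδ linearYonedaRightOpMap_comp
    (fun P _ => shortExact_linearYonedaRightOp (R := R) hS P) n).app X.unop)

/-- Both neighbouring terms are positive-degree `Ext` groups into the injective `X₂`, hence zero. -/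
theorem isIso_extIntoδ_succ {S : ShortComplex C} (hS : S.ShortExact) [Injective S.X₂] (n : ℕ) :
    IsIso (extIntoδ (R := R) hS (n + 1)) := by
  have (X : Cᵒᵖ) : IsIso ((extIntoδ (R := R) hS (n + 1)).app X) := by
    have := Functor.isIso_leftDerivedδ linearYonedaRightOpMap_comp
      (fun P _ => shortExact_linearYonedaRightOp (R := R) hS P) (n + 1) X.unop
      (isZero_extInto_succ_of_injective R (n + 1) X S.X₂).op
      (isZero_extInto_succ_of_injective R n X S.X₂).op
    exact isIso_unop ((Functor.leftDerivedδ linearYonedaRightOpMap_comp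
      (fun P _ => shortExact_linearYonedaRightOp (R := R) hS P) (n + 1)).app X.unop)
  exact NatIso.isIso_of_isIso_app _

instance preservesFiniteLimits_linearYoneda_obj (Y : ModuleCat.{u} R) :
    PreservesFiniteLimits ((linearYoneda R (ModuleCat.{u} R)).obj Y) where
  preservesFiniteLimits J _ _ :=
    have : PreservesLimitsOfShape J
        ((linearYoneda R (ModuleCat.{u} R)).obj Y ⋙ forget (ModuleCat.{u} R)) :=
      inferInstanceAs (PreservesLimitsOfShape J (yoneda.obj Y))
    preservesLimitsOfShape_of_reflects_of_preserves _ (forget (ModuleCat.{u} R))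

/-- `Ext⁰(-, Y)` is `Hom(-, Y)`. -/
noncomputable def extIntoZeroIso (Y : ModuleCat.{u} R) :
    extInto R 0 Y ≅ (linearYoneda R (ModuleCat.{u} R)).obj Y :=
  have : PreservesFiniteColimits (linearYonedaRightOp R Y) := preservesFiniteColimits_rightOp _
  let e := Functor.leftDerivedZeroIsoSelf (linearYonedaRightOp R Y)
  { hom := NatTrans.leftOp e.inv
    inv := NatTrans.leftOp e.hom
    hom_inv_id := by
      ext X : 2
      exact congrArg Quiver.Hom.unop (e.hom_inv_id_app X.unop)
    inv_hom_id := by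
      ext X : 2
      exact congrArg Quiver.Hom.unop (e.inv_hom_id_app X.unop) }

end Ext

/-! ### Local cohomology at a single ideal -/

section LocalCohomology

open localCohomology

variable (𝔞 : Ideal R) {T : Set (PrimeSpectrum R)}

/-- The inverse system `R / 𝔞ⁿ`. -/
abbrev quotientPowers : (ℕᵒᵖ)ᵒᵖ ⥤ (ModuleCat.{u} R)ᵒᵖ :=
  (ringModIdeals (idealPowersDiagram 𝔞)).op

/-- Local cohomology of `M` is the colimit of `Extⁱ(R / 𝔞ⁿ, M)`. -/
noncomputable def localCohomologyObjIso (i : ℕ) (M : ModuleCat.{u} R) :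
    (localCohomology 𝔞 i).obj M ≅ colimit (quotientPowers 𝔞 ⋙ extInto R i M) :=
  colimitObjIsoColimitCompEvaluation (diagram (idealPowersDiagram 𝔞) i) M

theorem map_mk_one_mem_torsion_powers {M : Type u} [AddCommGroup M] [Module R M] (n : ℕ)
    (ψ : (R ⧸ 𝔞 ^ n) →ₗ[R] M) :
    ψ (Submodule.Quotient.mk 1) ∈ (SystemOfIdeals.powers 𝔞).torsion M := by
  refine ⟨𝔞 ^ n, ⟨n, rfl⟩, fun r hr => ?_⟩
  rw [← map_smul, ← Submodule.Quotient.mk_smul, (Submodule.Quotient.mk_eq_zero _).2, map_zero]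
  exact Ideal.mul_mem_right _ _ hr

/-- Evaluation at `1` maps `Hom(R / 𝔞ⁿ, M)` to `Γ_𝔞(M)`. -/
def evalOneCocone (M : ModuleCat.{u} R) :
    Cocone (quotientPowers 𝔞 ⋙ (linearYoneda R (ModuleCat.{u} R)).obj M) where
  pt := (SystemOfIdeals.powers 𝔞).torsionFunctor.obj M
  ι :=
    { app n := ModuleCat.ofHom
        { toFun := fun (φ : (ringModIdeals (idealPowersDiagram 𝔞)).obj n.unop ⟶ M) =>
            ⟨φ.hom (Submodule.Quotient.mk (p := 𝔞 ^ n.unop.unop) 1),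
              map_mk_one_mem_torsion_powers 𝔞 n.unop.unop φ.hom⟩
          map_add' := fun _ _ => rfl
          map_smul' := fun _ _ => rfl }
      naturality _ _ _ := rfl }

/-- Evaluation at 1 is bijective: a map from `R ⧸ 𝔞 ^ n` is determined by the image of 1, which may
be any element killed by `𝔞 ^ n`. -/
theorem supportIn_colimit_hom_iff (M : ModuleCat.{u} R) :
    supportIn T (colimit (quotientPowers 𝔞 ⋙ (linearYoneda R (ModuleCat.{u} R)).obj M)) ↔
      supportIn T ((SystemOfIdeals.powers 𝔞).torsionFunctor.obj M) := by
  let e := colimit.desc _ (evalOneCocone 𝔞 M)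
  have he : Function.Injective e.hom := by
    refine (injective_iff_map_eq_zero e.hom).2 fun x hx => ?_
    obtain ⟨n, φ, rfl⟩ := Concrete.colimit_exists_rep _ x
    have hφ : ((evalOneCocone 𝔞 M).ι.app n).hom φ = 0 := by
      rw [← colimit.ι_desc]
      exact hx
    have hφ' : φ = 0 := by
      refine ModuleCat.hom_ext (Submodule.linearMap_qext _ (LinearMap.ext_ring ?_))
      exact Subtype.ext_iff.1 hφ
    rw [hφ']
    exact map_zero (colimit.ι (quotientPowers 𝔞 ⋙ (linearYoneda R (ModuleCat.{u} R)).obj M) n).hom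
  have he' : Function.Surjective e.hom := by
    rintro ⟨x, _, ⟨n, rfl⟩, hx⟩
    let φ : (ringModIdeals (idealPowersDiagram 𝔞)).obj (op n) ⟶ M := ModuleCat.ofHom
      (Submodule.liftQ (𝔞 ^ n) (LinearMap.toSpanSingleton R M x) hx)
    refine ⟨(colimit.ι (quotientPowers 𝔞 ⋙ (linearYoneda R (ModuleCat.{u} R)).obj M)
      (op (op n))).hom φ, ?_⟩
    refine (congrArg (fun g => g.hom φ)
      (colimit.ι_desc (evalOneCocone 𝔞 M) (op (op n)))).trans ?_
    exact Subtype.ext (one_smul R x)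
  exact ⟨supportIn_of_surjective e.hom he', supportIn_of_injective e.hom he⟩

theorem supportIn_localCohomology_zero_iff (M : ModuleCat.{u} R) :
    supportIn T ((localCohomology 𝔞 0).obj M) ↔
      supportIn T ((SystemOfIdeals.powers 𝔞).torsionFunctor.obj M) := by
  rw [← supportIn_colimit_hom_iff, supportIn_congr (localCohomologyObjIso 𝔞 0 M)]
  exact supportIn_congr (HasColimit.isoOfNatIso
    (Functor.isoWhiskerLeft (quotientPowers 𝔞) (extIntoZeroIso M)))

variable {S : ShortComplex (ModuleCat.{u} R)} (hS : S.ShortExact) [Injective S.X₂]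

include hS in
/-- Dimension shifting for local cohomology. -/
theorem supportIn_localCohomology_succ_iff
    (h : supportIn T ((SystemOfIdeals.powers 𝔞).torsionFunctor.obj S.X₂)) (i : ℕ) :
    supportIn T ((localCohomology 𝔞 i).obj S.X₃) ↔
      supportIn T ((localCohomology 𝔞 (i + 1)).obj S.X₁) := by
  rw [supportIn_congr (localCohomologyObjIso 𝔞 i S.X₃),
    supportIn_congr (localCohomologyObjIso 𝔞 (i + 1) S.X₁)]
  match i with
  | 0 =>
    -- In degree 0 the term from `X₂` need not vanish; it is only supported in `T`, which is where
    -- `h` enters.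
    rw [← supportIn_localCohomology_zero_iff, supportIn_congr (localCohomologyObjIso 𝔞 0 S.X₂)] at h
    exact supportIn_colimit_iff_of_exact_of_epi
      (Functor.whiskerLeft (quotientPowers 𝔞) (extIntoMap S.g 0))
      (Functor.whiskerLeft (quotientPowers 𝔞) (extIntoδ hS 0))
      (by rw [← Functor.whiskerLeft_comp, extIntoMap_comp_extIntoδ]; rfl)
      (fun n => exact_extIntoδ hS 0 _) (fun n => epi_extIntoδ hS 0 _) h
  | i + 1 =>
    have := isIso_extIntoδ_succ (R := R) hS i
    exact supportIn_congr (HasColimit.isoOfNatIso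
      (Functor.isoWhiskerLeft (quotientPowers 𝔞) (asIso (extIntoδ hS (i + 1)))))

end LocalCohomology

end

/-! ### Comparison of the two theories -/

section Comparison

variable {R : Type u} [CommRing R] {T : Set (PrimeSpectrum R)} (Φ : SystemOfIdeals R)

theorem SystemOfIdeals.supportIn_localCohomology_zero_iff (M : ModuleCat.{u} R) :
    supportIn T ((Φ.localCohomology 0).obj M) ↔ supportIn T (Φ.torsionFunctor.obj M) :=
  supportIn_congr (Φ.torsionFunctor.rightDerivedZeroIsoSelf.app M)

/-- Dimension shifting for general local cohomology. -/
theorem SystemOfIdeals.supportIn_localCohomology_succ_iff {S : ShortComplex (ModuleCat.{u} R)}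
    (hS : S.ShortExact) [Injective S.X₂] (h : supportIn T (Φ.torsionFunctor.obj S.X₂)) (i : ℕ) :
    supportIn T ((Φ.localCohomology i).obj S.X₃) ↔
      supportIn T ((Φ.localCohomology (i + 1)).obj S.X₁) := by
  match i with
  | 0 =>
    rw [Φ.supportIn_localCohomology_zero_iff]
    obtain ⟨p, w, hp, hex⟩ := Φ.torsionFunctor.exists_exact_rightDerived_one hS
    exact supportIn_iff_of_exact_of_epi hex hp h
  | i + 1 =>
    obtain ⟨e⟩ := Φ.torsionFunctor.nonempty_rightDerived_succ_succ_iso hS i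
    exact (supportIn_congr e).symm

theorem supportIn_localCohomology_iff [IsNoetherianRing R] (t : ℕ) (M : ModuleCat.{u} R) :
    (∀ i < t, supportIn T ((Φ.localCohomology i).obj M)) ↔
      ∀ i < t, ∀ 𝔞 ∈ Φ, supportIn T ((localCohomology 𝔞 i).obj M) := by
  induction t generalizing M with
  | zero => simp
  | succ t ih =>
    -- Degree 0 is split off; once it is known to hold, it provides the embedding into `E` used for
    -- the remaining degrees.
    rw [Nat.forall_lt_succ_left, Nat.forall_lt_succ_left, Φ.supportIn_localCohomology_zero_iff]
    simp only [supportIn_localCohomology_zero_iff]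
    rw [← supportIn_torsion_iff]
    refine and_congr_right fun hM => ?_
    obtain ⟨E, f, _, _, hE⟩ := exists_mono_injective_supportIn_torsion Φ M hM
    let S := ShortComplex.mk f (Limits.cokernel.π f) (Limits.cokernel.condition f)
    have hS : S.ShortExact := { exact := ShortComplex.exact_cokernel f }
    have : Injective S.X₂ := ‹Injective E›
    have h₁ (i : ℕ) := Φ.supportIn_localCohomology_succ_iff hS hE i
    have h₂ (i : ℕ) (𝔞 : Ideal R) (h𝔞 : 𝔞 ∈ Φ) := supportIn_localCohomology_succ_iff 𝔞 hS
      ((supportIn_torsion_iff Φ E).1 hE 𝔞 h𝔞) i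
    refine Iff.trans (forall₂_congr fun i _ => (h₁ i).symm) ((ih S.X₃).trans ?_)
    exact forall₂_congr fun i _ => forall₂_congr fun 𝔞 h𝔞 => h₂ i 𝔞 h𝔞

end Comparison

theorem corollary2p14 {R : Type u} [CommRing R] [IsNoetherianRing R]
    (Φ : SystemOfIdeals R) (M : ModuleCat.{u} R) (k : ℤ) :
    (∀ t : ℕ,
      (∀ i < t, dimLE R k ((Φ.localCohomology i).obj M)) ↔
        (∀ i < t, ∀ 𝔞 ∈ Φ, dimLE R k ((localCohomology 𝔞 i).obj M))) ∧
    ((∀ i : ℕ, dimLE R k ((Φ.localCohomology i).obj M)) ↔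
      (∀ i : ℕ, ∀ 𝔞 ∈ Φ, dimLE R k ((localCohomology 𝔞 i).obj M))) := by
  have key (t : ℕ) : (∀ i < t, dimLE R k ((Φ.localCohomology i).obj M)) ↔
      (∀ i < t, ∀ 𝔞 ∈ Φ, dimLE R k ((localCohomology 𝔞 i).obj M)) := by
    rcases lt_or_ge k (-1) with hk | hk
    -- Condition (ii) would be vacuous without a member of `Φ`; one is needed to contradict it.
    · obtain ⟨𝔞, h𝔞⟩ := Φ.nonempty
      exact ⟨fun h i hi => absurd (h i hi) (not_dimLE_of_lt hk _),
        fun h i hi => absurd (h i hi 𝔞 h𝔞) (not_dimLE_of_lt hk _)⟩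
    · obtain ⟨T, hT⟩ := exists_dimLE_iff_supportIn (R := R) hk
      simp only [hT]
      exact supportIn_localCohomology_iff Φ t M
  -- A statement in degree `i` follows from the truncated equivalence with `t = i + 1`.
  refine ⟨key, fun h i => ?_, fun h i => ?_⟩
  · exact (key (i + 1)).1 (fun j _ => h j) i i.lt_succ_self
  · exact (key (i + 1)).2 (fun j _ => h j) i i.lt_succ_self
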